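/- **Setting.** Let $\Phi$ be a finite (reduced, crystallographic) root system with simple roots $\{\alpha_i\}_{i\in I}$, coroots $\alpha^\vee$, fundamental weights $\omega_i$, weight lattice $\Lambda$ and dominant weights $\Lambda^+$. For $J\subseteq I$ let $\Phi_J$ be the root subsystem with simple roots $\{\alpha_j\}_{j\in J}$, $W_J=\langle s_j: j\in J\rangle$ its Weyl group, $\omega_j^J$ ($j\in J$) its fundamental weights (so $\omega^J_j\in\mathrm{span}\{\alpha_k\}_{k\in J}$ and $\langle\omega^J_j,\alpha_k^\vee\rangle=\delta_{jk}$ for $k\in J$), $\Lambda_{\Phi_J}^+$ its dominant weights, $\varrho^J=\sum_{j\in J}\omega_j^J$, and, for $\lambda\in\Lambda_{\Phi_J}^+$, $\chi^{\Phi_J}_\lambda=\mathcal A(e^{\lambda+\varrho^J})/\mathcal A(e^{\varrho^J})$ with $\mathcal A(e^\mu)=\sum_{w\in W_J}\det(w)e^{w(\mu)}$. **Admissible systems.** An admissible system is a finite nonempty set $X$ with maps $\mu,\overline\delta:X\to\Lambda$ and maps $\widetilde F_i$ ($i\in I$) between subsets of $X$ such that, with $\varepsilon:=\mu-\overline\delta$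 and $\overline\delta(x,i):=\langle\overline\delta(x),\alpha_i^\vee\rangle$, $\varepsilon(x,i):=\langle\varepsilon(x),\alpha_i^\vee\rangle$: - (A1) $\overline\delta(x)\in-\Lambda^+$ and $\varepsilon(x)\in\Lambda^+$ for all $x\in X$; - (A2) $\widetilde F_i$ is a bijection $\{x:\varepsilon(x,i)>0\}\to\{x:\overline\delta(x,i)<0\}$; - (A3) if $\widetilde F_i(x)$ is defined, then $\mu(\widetilde F_i(x))=\mu(x)-\alpha_i$ and $\overline\delta(\widetilde F_i(x),i)=\overline\delta(x,i)-1$; - (A4) there is a coherent timing pattern: a real-valued function $t(x,i)$, defined whenever $\overline\delta(x,i)<0$, such that whenever $t(x,i)$ and $\widetilde F_i(x)$ are defined, (i) $t(x,i)\le t(\widetilde F_i(x),i)$, and (ii) for all $j\ne i$, all integers $d<0$ and all real $T\le t(x,i)$, there is $y\succeq_j x$ with $\overline\delta(y,j)=d$ and $t(y,j)=T$ if and only if there is $y'\succeq_j\widetilde F_i(x)$ with $\overline\delta(y',j)=d$ and $t(y',j)=T$. Here $x\preceq_j y$ means $x=\widetilde F_j^k(y)$ for some $k\ge0$. The edge-colored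 directed graph $\mathcal G(X)=\mathcal G_{\text{adm-syst}}(X)$ has vertex set $X$ and an edge $s\xrightarrow{i}t$ if and only if $s=\widetilde F_i(t)$. **Posets.** Let $R$ be a finite ranked poset whose Hasse diagram edges are colored by $I$. The $i$-component $\mathbf{comp}_i(x)$ is the connected component of $x$ in the graph of edges of color $i$; $\rho_i(x)$ is the rank of $x$ in it, $l_i(x)$ its length, $\delta_i=l_i-\rho_i$, $m_i=\rho_i-\delta_i$, $wt^J(x)=\sum_{j\in J}m_j(x)\omega_j^J$ and $wt=wt^I$. $R$ is fibrous if all its $i$-components ($i\in I$) are chains, and $M_\Phi$-structured if $wt(s)+\alpha_i=wt(t)$ for every edge $s\xrightarrow{i}t$. Let $\mathrm{WGF}(R)=\sum_{x\in R}e^{wt(x)}$ and $\mathrm{WGF}(R)|_J=\sum_{x\in R}e^{wt^J(x)}$. For $J\subseteq I$ and $\nu=\sum_{j\in J}\nu_j\omega_j^J\in\Lambda_{\Phi_J}^+$ put $\mathcal K_{J,\nu}(x)=\{j\in J:\delta_j(x)>\nu_j\}$ and $\mathcal M_{J,\nu}(R)=\{x\in R:\delta_j(x)\le\nu_j\text{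 for all }j\in J\}$. For fibrous $R$, let $U_j(x,p)$ be the set of the topmost $1+p$ elements of the chain $\mathbf{comp}_j(x)$ (all of it, if it has fewer). A $(J,\nu)$-coloring of $R$ is a function $\kappa:R\setminus\mathcal M_{J,\nu}(R)\to J$ such that, for every $x\in R\setminus\mathcal M_{J,\nu}(R)$ and $j=\kappa(x)$, $\{y\in\mathbf{comp}_j(x): y\notin\mathcal M_{J,\nu}(R),\ \kappa(y)=j\}=\mathbf{comp}_j(x)\setminus U_j(x,\nu_j)$. $R$ is a crystalline splitting poset if it is $M_\Phi$-structured and fibrous and, for all $J\subseteq I$ and $\nu\in\Lambda_{\Phi_J}^+$, there is a subset $\mathcal S\subseteq R$ with $\nu+wt^J(s)\in\Lambda_{\Phi_J}^+$ for all $s\in\mathcal S$ and $\chi^{\Phi_J}_\nu\cdot\mathrm{WGF}(R)|_J=\sum_{s\in\mathcal S}\chi^{\Phi_J}_{\nu+wt^J(s)}$. **Theorem 7.2.** Let $X$ be an admissible system. Then $\mathcal G(X)$ is the edge-colored Hasse diagram of a ranked poset that is fibrous and $M_\Phi$-structured. Fix a coherent timing pattern $t$ and a total order on $I$. Then for all $J\subseteq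 I$ and $\nu\in\Lambda_{\Phi_J}^+$, for each $x\in\mathcal G(X)\setminus\mathcal M_{J,\nu}(\mathcal G(X))$ and $k\in\mathcal K_{J,\nu}(x)$ there is a unique $x^{(k)}\in\mathbf{comp}_k(x)$ with $\delta_k(x^{(k)})=\nu_k+1$, and the function $\kappa:\mathcal G(X)\setminus\mathcal M_{J,\nu}(\mathcal G(X))\to J$ given by $$\kappa(x)=\min\Big\{i\in\mathcal K_{J,\nu}(x): t(x^{(i)},i)=\min_{k\in\mathcal K_{J,\nu}(x)}t(x^{(k)},k)\Big\}$$ is well defined and is a $(J,\nu)$-coloring of $\mathcal G(X)$. In particular, $\mathcal G(X)$ is a crystalline splitting poset, and for all $J\subseteq I$ and $\nu\in\Lambda_{\Phi_J}^+$ one has $\nu+wt^J(m)\in\Lambda_{\Phi_J}^+$ for each $m\in\mathcal M_{J,\nu}(\mathcal G(X))$ and $$\chi^{\Phi_J}_\nu\cdot\mathrm{WGF}(\mathcal G(X))|_J=\sum_{m\in\mathcal M_{J,\nu}(\mathcal G(X))}\chi^{\Phi_J}_{\nu+wt^J(m)}.$$ -/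

import Mathlib

open scoped BigOperators

noncomputable section

namespace SplittingPoset

/-! ### Edge-colored directed graphs and ranked posets -/

/-- An edge-colored directed graph with vertex set `X` and colors from `I`:
`R i s t` means that there is an edge `s → t` of color `i`. -/
abbrev ColoredGraph (I X : Type*) := I → X → X → Prop

section Graph

variable {I X : Type*}

/-- `R` is the edge-colored Hasse diagram of a ranked poset: every edge has exactly one color, the
edges are exactly the covering relations of a partial order on `X` (which is the one generated by
the edges), and there is a surjective rank function `ρ : X → {0, …, l}`. -/
structure IsRankedPoset (R : ColoredGraph I X) : Prop where
  color_unique : ∀ i j s t, R i s t → R j s t → i = j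
  hasse : ∃ _ : PartialOrder X,
    (∀ s t : X, s ≤ t ↔ Relation.ReflTransGen (fun a b => ∃ i, R i a b) s t) ∧
    (∀ s t : X, (∃ i, R i s t) ↔ s ⋖ t)
  ranked : ∃ (l : ℕ) (ρ : X → ℕ), Set.range ρ = Set.Iic l ∧
    ∀ i s t, R i s t → ρ s + 1 = ρ t

/-- The `i`-component of `x`: all vertices that are joined to `x` by a path, whose edges may be
followed in either direction, of edges of color `i`. -/
def comp (R : ColoredGraph I X) (i : I) (x : X) : Set X := {y | Relation.EqvGen (R i) x y}

/-- `ρ` restricts to the rank function of each `i`-component: it increases by one along each edge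
of color `i`, and its smallest value on each `i`-component is zero. -/
def IsColorRank (R : ColoredGraph I X) (i : I) (ρ : X → ℕ) : Prop :=
  (∀ s t, R i s t → ρ s + 1 = ρ t) ∧ ∀ x, ∃ y ∈ comp R i x, ρ y = 0

theorem IsColorRank.unique {R : ColoredGraph I X} {i : I} {ρ ρ' : X → ℕ}
    (h : IsColorRank R i ρ) (h' : IsColorRank R i ρ') : ρ = ρ' := by
  have key : ∀ x y, Relation.EqvGen (R i) x y → (ρ x : ℤ) - ρ' x = ρ y - ρ' y := by
    intro x y hxy
    induction hxy with
    | rel a b hab => have h1 := h.1 a b hab; have h2 := h'.1 a b hab; omega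
    | refl a => rfl
    | symm a b _ ih => exact ih.symm
    | trans a b c _ _ ih1 ih2 => exact ih1.trans ih2
  funext x
  obtain ⟨y, hy, hy0⟩ := h.2 x
  obtain ⟨z, hz, hz0⟩ := h'.2 x
  have h1 := key x y hy
  have h2 := key x z hz
  omega

/-- A ranked poset has, for each color `i`, a rank function on its `i`-components. -/
theorem IsRankedPoset.exists_isColorRank {R : ColoredGraph I X} (hR : IsRankedPoset R) (i : I) :
    ∃ ρ, IsColorRank R i ρ := by
  obtain ⟨l, ρ, -, hρ⟩ := hR.ranked
  have hcomp : ∀ s t, Relation.EqvGen (R i) s t → comp R i s = comp R i t := by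
    intro s t hst
    ext y
    exact ⟨fun h => (hst.symm).trans _ _ _ h, fun h => hst.trans _ _ _ h⟩
  have hne : ∀ x, (ρ '' comp R i x).Nonempty :=
    fun x => ⟨ρ x, x, Relation.EqvGen.refl x, rfl⟩
  have hle : ∀ x, sInf (ρ '' comp R i x) ≤ ρ x :=
    fun x => Nat.sInf_le ⟨x, Relation.EqvGen.refl x, rfl⟩
  refine ⟨fun x => ρ x - sInf (ρ '' comp R i x), ?_, ?_⟩
  · intro s t hst
    have h1 := hρ i s t hst
    have h2 := hle s
    have h3 := hcomp s t (Relation.EqvGen.rel _ _ hst)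
    simp only [← h3]
    omega
  · intro x
    obtain ⟨y, hy, hy'⟩ := Nat.sInf_mem (hne x)
    refine ⟨y, hy, ?_⟩
    simp only [← hcomp x y hy, hy', Nat.sub_self]

open Classical in
/-- `ρ_i(x)`, the rank of `x` in its `i`-component. -/
def colorRank (R : ColoredGraph I X) (i : I) : X → ℕ :=
  if h : ∃ ρ, IsColorRank R i ρ then h.choose else 0

/-- `l_i(x)`, the length of the `i`-component of `x`. -/
def colorLength (R : ColoredGraph I X) (i : I) (x : X) : ℕ :=
  sSup (colorRank R i '' comp R i x)

/-- `δ_i(x) = l_i(x) - ρ_i(x)`. -/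
def colorDepth (R : ColoredGraph I X) (i : I) (x : X) : ℕ :=
  colorLength R i x - colorRank R i x

/-- `m_i(x) = ρ_i(x) - δ_i(x)`. -/
def colorWeight (R : ColoredGraph I X) (i : I) (x : X) : ℤ :=
  (colorRank R i x : ℤ) - (colorDepth R i x : ℤ)

/-- `R` is fibrous: for every color `i`, each `i`-component is a chain. -/
def IsFibrous (R : ColoredGraph I X) : Prop :=
  ∀ i x, ∀ y ∈ comp R i x, ∀ z ∈ comp R i x,
    Relation.ReflTransGen (R i) y z ∨ Relation.ReflTransGen (R i) z y

/-- `K_{J,ν}(x) = {j ∈ J | δ_j(x) > ν_j}`. -/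
def kSet (R : ColoredGraph I X) (J : Finset I) (ν : J → ℕ) (x : X) : Set J :=
  {j | ν j < colorDepth R j x}

/-- `M_{J,ν}(R) = {m ∈ R | δ_j(m) ≤ ν_j for all j ∈ J}`. -/
def mSet (R : ColoredGraph I X) (J : Finset I) (ν : J → ℕ) : Set X :=
  {x | ∀ j : J, colorDepth R j x ≤ ν j}

/-- `U_i(x,p)`, the set of the topmost `1 + p` elements of the `i`-component of `x` (all of it if
it has fewer elements): the elements with fewer than `1 + p` elements of the chain strictly
above them. -/
def upperPart (R : ColoredGraph I X) (i : I) (x : X) (p : ℕ) : Set X :=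
  {y ∈ comp R i x | {z | Relation.TransGen (R i) y z}.ncard < 1 + p}

/-- `κ` is a `(J,ν)`-coloring of the vertices of `R`. -/
def IsVertexColoring (R : ColoredGraph I X) (J : Finset I) (ν : J → ℕ)
    (κ : {x : X // x ∉ mSet R J ν} → J) : Prop :=
  ∀ x, {y ∈ comp R (κ x) x | ∃ hy : y ∉ mSet R J ν, κ ⟨y, hy⟩ = κ x} =
    comp R (κ x) x \ upperPart R (κ x) x (ν (κ x))

end Graph

/-! ### Weights, the Weyl group and Weyl bialternants of root subsystems

`P` is a finite reduced crystallographic root system `Φ` in the real vector space `V`, and `b` is a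
choice of simple roots, with index set `I = b.support`. -/

section Roots

variable {ι V N : Type*} [AddCommGroup V] [Module ℝ V] [AddCommGroup N] [Module ℝ N]
  {P : RootPairing ι ℝ V N} (b : P.Base)

/-- The real number `⟨v, α_i^∨⟩`. -/
def pair (i : b.support) (v : V) : ℝ := P.toLinearMap v (P.coroot i)

open Classical in
/-- The fundamental weight `ω_j^J = ∑_{k ∈ J} Q^J_{jk} α_k` of the root subsystem `Φ_J`, where `Q^J`
is the inverse of the submatrix `(⟨α_j, α_k^∨⟩)_{j,k ∈ J}` of the Cartan matrix. -/
def fundWeight (J : Finset b.support) (j : J) : V :=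
  ∑ k : J, ((Matrix.of fun j k : J => pair b k (P.root j.1))⁻¹ j k) • P.root k.1

/-- The weight `∑_{j ∈ J} ν_j ω_j^J` of `Φ_J` with integer coordinates `ν`. -/
def weightOf (J : Finset b.support) (ν : J → ℤ) : V := ∑ j : J, ν j • fundWeight b J j

/-- The set `Λ_{Φ_J}^+` of dominant weights of `Φ_J`. -/
def dominantWeights (J : Finset b.support) : Set V :=
  Set.range fun ν : J → ℕ => weightOf b J fun j => (ν j : ℤ)

/-- `ϱ^J = ∑_{j ∈ J} ω_j^J`. -/
def rho (J : Finset b.support) : V := weightOf b J fun _ => 1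

/-- The projection `v ↦ v^J = ∑_{j ∈ J} ⟨v, α_j^∨⟩ ω_j^J` of `V` onto the span of `Φ_J`. -/
def proj (J : Finset b.support) (v : V) : V := ∑ j : J, pair b j.1 v • fundWeight b J j

/-- The subgroup `W_J` of the Weyl group, generated by the simple reflections `s_j`, `j ∈ J`. It is
isomorphic to the Weyl group of `Φ_J`, by restriction to the span of `Φ_J`. -/
def weylGroup (J : Finset b.support) : Subgroup (V ≃ₗ[ℝ] V) :=
  Subgroup.closure (Set.range fun j : J => P.reflection j.1)

/-- The finiteness of `W_J`, which makes the sums over `W_J` below finite sums. -/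
instance [Finite ι] [P.IsRootSystem] (J : Finset b.support) : Finite (weylGroup b J) := by
  have hmem : ∀ w : weylGroup b J, ∀ i : ι, ∃ k : ι, P.root k = w.1 (P.root i) := by
    rintro ⟨w, hw⟩
    induction hw using Subgroup.closure_induction'' with
    | mem x hx =>
      obtain ⟨j, rfl⟩ := hx
      exact fun i => ⟨P.reflectionPerm j.1 i, by simp⟩
    | inv_mem x hx =>
      obtain ⟨j, rfl⟩ := hx
      refine fun i => ⟨P.reflectionPerm j.1 i, ?_⟩
      rw [P.root_reflectionPerm]
      change _ = (P.reflection j.1).symm _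
      rw [show (P.reflection j.1).symm = P.reflection j.1 from P.reflection_inv j.1]
    | one => exact fun i => ⟨i, rfl⟩
    | mul x y _ _ ihx ihy =>
      intro i
      obtain ⟨k, hk⟩ := ihy i
      obtain ⟨l, hl⟩ := ihx k
      exact ⟨l, by rw [hl, hk]; rfl⟩
  choose f hf using hmem
  refine Finite.of_injective f fun w w' h => ?_
  apply Subtype.ext
  apply LinearEquiv.toLinearMap_injective
  apply LinearMap.ext_on_range (v := P.root) RootPairing.IsRootSystem.span_root_eq_top
  intro i
  change w.1 (P.root i) = w'.1 (P.root i)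
  rw [← hf, ← hf, h]

/-- The formal exponential `e^v`. The group ring of the weight lattice of each `Φ_J` is a subring
of the group ring `ℤ[V]`, in which all computations are made. -/
def expo (v : V) : AddMonoidAlgebra ℤ V := AddMonoidAlgebra.single v 1

/-- `𝒜(e^v) = ∑_{w ∈ W_J} det(w) e^{w(v)}`. As `det(w) = ± 1`, it is the same as its sign. -/
def alternant (J : Finset b.support) (v : V) : AddMonoidAlgebra ℤ V :=
  ∑ᶠ w : weylGroup b J,
    ((SignType.sign (LinearMap.det (w.1 : V →ₗ[ℝ] V)) : SignType) : ℤ) • expo (w.1 v)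

instance groupRing_isDomain : IsDomain (AddMonoidAlgebra ℤ V) := by
  let _ : Module ℚ V := Module.compHom V (algebraMap ℚ ℝ)
  have : TwoUniqueSums V := inferInstance
  infer_instance

/-- The Weyl bialternant `χ_λ^{Φ_J} = 𝒜(e^{λ+ϱ}) / 𝒜(e^ϱ)`, as an element of the field of fractions
of the group ring, which contains the group ring as a subring. -/
def bialternant (J : Finset b.support) (v : V) : FractionRing (AddMonoidAlgebra ℤ V) :=
  algebraMap (AddMonoidAlgebra ℤ V) _ (alternant b J (v + rho b J)) /
    algebraMap (AddMonoidAlgebra ℤ V) _ (alternant b J (rho b J))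

/-- The restriction `χ|_J = ∑ c_μ e^{μ^J}` of `χ = ∑ c_μ e^μ`. -/
def restrict (J : Finset b.support) (χ : AddMonoidAlgebra ℤ V) : AddMonoidAlgebra ℤ V :=
  AddMonoidAlgebra.mapDomain (proj b J) χ

/-! ### Weights of vertices and crystalline splitting posets -/

variable {X : Type*}

/-- The `J`-weight `wt^J(x) = ∑_{j ∈ J} m_j(x) ω_j^J`. -/
def wt (R : ColoredGraph b.support X) (J : Finset b.support) (x : X) : V :=
  weightOf b J fun j => colorWeight R j x

/-- `R` is `M_Φ`-structured: `wt(s) + α_i = wt(t)` for each edge `s → t` of color `i`. -/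
def IsStructured (R : ColoredGraph b.support X) : Prop :=
  ∀ i s t, R i s t → wt b R Finset.univ s + P.root i = wt b R Finset.univ t

/-- The weight generating function `WGF(R) = ∑_{x ∈ R} e^{wt(x)}`. -/
def wgf [Fintype X] (R : ColoredGraph b.support X) : AddMonoidAlgebra ℤ V :=
  ∑ x : X, expo (wt b R Finset.univ x)

open Classical in
/-- The identity `χ_ν^{Φ_J} ⬝ WGF(R)|_J = ∑_{s ∈ S} χ_{ν + wt^J(s)}^{Φ_J}`, for the weight `ν` of
`Φ_J`. -/
def SplittingIdentity [Fintype X] (R : ColoredGraph b.support X) (J : Finset b.support)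
    (ν : J → ℕ) (S : Set X) : Prop :=
  bialternant b J (weightOf b J fun j => (ν j : ℤ)) *
      algebraMap (AddMonoidAlgebra ℤ V) _ (restrict b J (wgf b R)) =
    ∑ s : X with s ∈ S, bialternant b J ((weightOf b J fun j => (ν j : ℤ)) + wt b R J s)

/-- `R` is a crystalline splitting poset: it is an `M_Φ`-structured and fibrous poset, and for each
`J ⊆ I` and each dominant weight `ν` of `Φ_J` it is a `(J,ν)`-splitting poset, with respect to
some set `S_{J,ν}(R)` of vertices. -/
structure IsCrystallineSplittingPoset [Fintype X] (R : ColoredGraph b.support X) : Prop where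
  rankedPoset : IsRankedPoset R
  structured : IsStructured b R
  fibrous : IsFibrous R
  splitting : ∀ (J : Finset b.support) (ν : J → ℕ), ∃ S : Set X,
    (∀ s ∈ S, (weightOf b J fun j => (ν j : ℤ)) + wt b R J s ∈ dominantWeights b J) ∧
    SplittingIdentity b R J ν S

end Roots

/-! ### Stembridge's admissible systems -/

section Admissible

variable {ι V N : Type*} [AddCommGroup V] [Module ℝ V] [AddCommGroup N] [Module ℝ N]
  {P : RootPairing ι ℝ V N}

/-- The data `(X, μ, δ, {F_i})` of an admissible system. The map `F i` matters only on its domain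
of definition `{x | ε(x,i) > 0}`. -/
structure SystemData (b : P.Base) (X : Type*) where
  μ : X → V
  δ : X → V
  F : b.support → X → X

namespace SystemData

variable {b : P.Base} {X : Type*} (D : SystemData b X)

/-- `ε(x) = μ(x) - δ(x)`. -/
def ε (x : X) : V := D.μ x - D.δ x

/-- The edge-colored directed graph of the system: there is an edge `s → t` of color `i` if and only
if `F_i(t)` is defined and equal to `s`. -/
def graph : ColoredGraph b.support X := fun i s t => 0 < pair b i (D.ε t) ∧ D.F i t = s

/-- `x ⪯_i y`, i.e. `x = F_i^k(y)` for some `k ≥ 0`. -/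
def le (i : b.support) (x y : X) : Prop := Relation.ReflTransGen (D.graph i) x y

/-- `t` is a coherent timing pattern. The value `t x i` matters only if `δ(x,i) < 0`. -/
structure IsCoherentTiming (t : X → b.support → ℝ) : Prop where
  mono : ∀ x i, pair b i (D.δ x) < 0 → 0 < pair b i (D.ε x) → t x i ≤ t (D.F i x) i
  coherent : ∀ x i, pair b i (D.δ x) < 0 → 0 < pair b i (D.ε x) →
    ∀ j, j ≠ i → ∀ d : ℤ, d < 0 → ∀ T : ℝ, T ≤ t x i →
      ((∃ y, D.le j x y ∧ pair b j (D.δ y) = d ∧ t y j = T) ↔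
        ∃ y, D.le j (D.F i x) y ∧ pair b j (D.δ y) = d ∧ t y j = T)

/-- The axioms of an admissible system. -/
structure IsAdmissible : Prop where
  neg_δ_dominant : ∀ x, -D.δ x ∈ dominantWeights b Finset.univ
  ε_dominant : ∀ x, D.ε x ∈ dominantWeights b Finset.univ
  bijOn : ∀ i, Set.BijOn (D.F i) {x | 0 < pair b i (D.ε x)} {x | pair b i (D.δ x) < 0}
  μ_F : ∀ i x, 0 < pair b i (D.ε x) → D.μ (D.F i x) = D.μ x - P.root i
  δ_F : ∀ i x, 0 < pair b i (D.ε x) → pair b i (D.δ (D.F i x)) = pair b i (D.δ x) - 1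
  timing : ∃ t : X → b.support → ℝ, D.IsCoherentTiming t

/-- `x^{(k)}`: the element of the `k`-component of `x` with `δ_k(x^{(k)}) = ν_k + 1`. -/
def markedPoint (J : Finset b.support) (ν : J → ℕ) (x : X) (k : J) : X :=
  @Classical.epsilon X ⟨x⟩ fun y =>
    y ∈ comp D.graph k x ∧ colorDepth D.graph k y = ν k + 1

/-- The set `{i ∈ K_{J,ν}(x) | t(x^{(i)}, i) = min_{k ∈ K_{J,ν}(x)} t(x^{(k)}, k)}` of the colors of
minimal timing. -/
def earliestColors (t : X → b.support → ℝ) (J : Finset b.support) (ν : J → ℕ) (x : X) : Set J :=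
  {i | i ∈ kSet D.graph J ν x ∧ ∀ k ∈ kSet D.graph J ν x,
    t (D.markedPoint J ν x i) i ≤ t (D.markedPoint J ν x k) k}

end SystemData

end Admissible

end SplittingPoset

end

open SplittingPoset

/-!
The axioms on `μ`, `δ` and `F_i` say that the edges of color `i` cut `X` into finite chains
(strings), on which `ε(x,i)` is the rank and `-δ(x,i)` the depth (`IsAdmissible.stringLengths`).
Hence `wt = μ`, and `μ(F_i(x)) = μ(x) - α_i` says that the graph is structured. A linear functional that is one on every simple root
increases by one along each edge, which makes the graph the Hasse diagram of a ranked poset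
(`isRankedPoset_of_height`).

For the coloring, compare `x` with `F_j(x)` on a `j`-string, both of depth greater than `ν_j`. They
have the same marked point for `j`, and the timing `T` of the marked point is at most `t(x,j)`, as
timing increases downwards. So coherence applies to all times up to `T`: a color `k ≠ j` competes
with `j` at `x` if and only if it does at `F_j(x)`, with the same timing. Hence `j` is chosen at
both or at none of them (`isLeast_earliestColors_F`), and the part of a `j`-string below its topmost
`1 + ν_j` elements has color `j` as soon as one of its elements has.

Any coloring gives the splitting identity (`IsStructured.splittingIdentity`). Reversal of the
`j`-strings shows that `∑ e^{wt^J(x)}` is invariant under `W_J`, so its product with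
`𝒜(e^{ν+ϱ^J})` is `∑ 𝒜(e^{ν+ϱ^J+wt^J(x)})`. Reversal of the colored parts of the strings is an
involution outside `M_{J,ν}` that acts on the weights `ν + ϱ^J + wt^J(x)` by simple reflections,
which change the sign of the alternant; these terms cancel
(`IsStructured.sum_alternant_eq_zero`). The cancellation takes place before the division by
`𝒜(e^{ϱ^J})`, as an identity in the group ring.
-/

namespace SplittingPoset

/-! ### Strings -/

/-- The relation `r` decomposes `X` into strings (finite chains): every element has at most one
neighbour above and at most one below, `e x` counts the steps that can be made downwards from `x`
and `d x` the steps that can be made upwards. -/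
structure StringLengths {X : Type*} (r : X → X → Prop) (e d : X → ℕ) : Prop where
  left_unique : ∀ {x y z}, r x z → r y z → x = y
  right_unique : ∀ {x y z}, r x y → r x z → y = z
  e_succ : ∀ {x y}, r x y → e x + 1 = e y
  d_succ : ∀ {x y}, r x y → d y + 1 = d x
  exists_below : ∀ {y}, 0 < e y → ∃ x, r x y
  exists_above : ∀ {x}, 0 < d x → ∃ y, r x y

namespace StringLengths

variable {X : Type*} {r : X → X → Prop} {e d : X → ℕ}

theorem total (h : StringLengths r e d) {x y : X} (hxy : Relation.EqvGen r x y) :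
    Relation.ReflTransGen r x y ∨ Relation.ReflTransGen r y x := by
  induction hxy with
  | rel x y hxy => exact Or.inl (.single hxy)
  | refl x => exact Or.inl .refl
  | symm x y _ ih => exact ih.symm
  | trans x y z _ _ ih₁ ih₂ =>
    rcases ih₁ with h₁ | h₁ <;> rcases ih₂ with h₂ | h₂
    · exact Or.inl (h₁.trans h₂)
    · have := Relation.ReflTransGen.total_of_right_unique (r := Function.swap r)
        (fun _ _ _ hab hac => h.left_unique hab hac)
        (Relation.reflTransGen_swap.mpr h₁) (Relation.reflTransGen_swap.mpr h₂)
      exact (this.imp Relation.reflTransGen_swap.mp Relation.reflTransGen_swap.mp).symm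
    · exact Relation.ReflTransGen.total_of_right_unique
        (fun _ _ _ hab hac => h.right_unique hab hac) h₁ h₂
    · exact Or.inr (h₂.trans h₁)

theorem add_eq (h : StringLengths r e d) {x y : X} (hxy : Relation.EqvGen r x y) :
    e x + d x = e y + d y := by
  induction hxy with
  | rel x y hxy => have := h.e_succ hxy; have := h.d_succ hxy; omega
  | refl x => rfl
  | symm x y _ ih => exact ih.symm
  | trans x y z _ _ ih₁ ih₂ => exact ih₁.trans ih₂

theorem le_of_reflTransGen (h : StringLengths r e d) {x y : X}
    (hxy : Relation.ReflTransGen r x y) : d y ≤ d x := by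
  induction hxy with
  | refl => rfl
  | tail _ hyz ih => have := h.d_succ hyz; omega

theorem lt_of_transGen (h : StringLengths r e d) {x y : X}
    (hxy : Relation.TransGen r x y) : d y < d x := by
  induction hxy with
  | single hxy => have := h.d_succ hxy; omega
  | tail _ hyz ih => have := h.d_succ hyz; omega

theorem eq_of_d_eq (h : StringLengths r e d) {x y : X} (hxy : Relation.EqvGen r x y)
    (hd : d x = d y) : x = y := by
  rcases h.total hxy with h₁ | h₁ <;>
  · rcases Relation.reflTransGen_iff_eq_or_transGen.mp h₁ with h₂ | h₂
    · first | exact h₂ | exact h₂.symm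
    · have := h.lt_of_transGen h₂; omega

theorem exists_d_eq_above (h : StringLengths r e d) {x : X} {n : ℕ} (hn : n ≤ d x) :
    ∃ y, Relation.ReflTransGen r x y ∧ d y = n := by
  induction hm : d x - n generalizing x with
  | zero => exact ⟨x, .refl, by omega⟩
  | succ m ih =>
    obtain ⟨z, hz⟩ := h.exists_above (x := x) (by omega)
    have := h.d_succ hz
    obtain ⟨y, hy, hy'⟩ := ih (x := z) (by omega) (by omega)
    exact ⟨y, hy.head hz, hy'⟩

theorem exists_e_eq_below (h : StringLengths r e d) {x : X} {n : ℕ} (hn : n ≤ e x) :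
    ∃ y, Relation.ReflTransGen r y x ∧ e y = n := by
  induction hm : e x - n generalizing x with
  | zero => exact ⟨x, .refl, by omega⟩
  | succ m ih =>
    obtain ⟨z, hz⟩ := h.exists_below (y := x) (by omega)
    have := h.e_succ hz
    obtain ⟨y, hy, hy'⟩ := ih (x := z) (by omega) (by omega)
    exact ⟨y, hy.tail hz, hy'⟩

theorem reflTransGen_eqvGen {x y : X} (h : Relation.ReflTransGen r x y) :
    Relation.EqvGen r x y := Relation.EqvGen.reflTransGen_le_eqvGen _ _ _ h

theorem exists_e_eq (h : StringLengths r e d) {x : X} {n : ℕ} (hn : n ≤ e x + d x) :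
    ∃ y, Relation.EqvGen r x y ∧ e y = n := by
  rcases le_total n (e x) with hx | hx
  · obtain ⟨y, hy, hy'⟩ := h.exists_e_eq_below hx
    exact ⟨y, (reflTransGen_eqvGen hy).symm, hy'⟩
  · obtain ⟨y, hy, hy'⟩ := h.exists_d_eq_above (x := x) (n := e x + d x - n) (by omega)
    have := h.add_eq (reflTransGen_eqvGen hy)
    exact ⟨y, reflTransGen_eqvGen hy, by omega⟩

/-- An element of a string is below exactly `d x` elements. -/
theorem ncard_above (h : StringLengths r e d) (x : X) :
    {z | Relation.TransGen r x z}.ncard = d x := by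
  have hinj : Set.InjOn d {z | Relation.TransGen r x z} := fun y hy z hz hyz =>
    h.eq_of_d_eq ((reflTransGen_eqvGen (Relation.TransGen.to_reflTransGen hy)).symm.trans _ _ _
      (reflTransGen_eqvGen (Relation.TransGen.to_reflTransGen hz))) hyz
  have himage : d '' {z | Relation.TransGen r x z} = Set.Iio (d x) := by
    ext n
    constructor
    · rintro ⟨z, hz, rfl⟩
      exact h.lt_of_transGen hz
    · intro hn
      obtain ⟨y, hy, rfl⟩ := h.exists_d_eq_above (le_of_lt (Set.mem_Iio.mp hn))
      rcases Relation.reflTransGen_iff_eq_or_transGen.mp hy with rfl | hy'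
      · exact absurd hn (lt_irrefl (d _))
      · exact ⟨y, hy', rfl⟩
  rw [← hinj.ncard_image, himage, Set.ncard_eq_toFinset_card', Set.toFinset_Iio, Nat.card_Iio]

section Graph

variable {I : Type*} {R : ColoredGraph I X} {i : I}

theorem colorRank_eq (h : StringLengths (R i) e d) : colorRank R i = e := by
  have he : IsColorRank R i e := by
    refine ⟨fun s t => h.e_succ, fun x => ?_⟩
    exact h.exists_e_eq (Nat.zero_le _)
  have hex : ∃ ρ, IsColorRank R i ρ := ⟨e, he⟩
  rw [colorRank, dif_pos hex]
  exact hex.choose_spec.unique he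

theorem colorLength_eq (h : StringLengths (R i) e d) (x : X) :
    colorLength R i x = e x + d x := by
  rw [colorLength, h.colorRank_eq]
  refine IsGreatest.csSup_eq ⟨h.exists_e_eq le_rfl, ?_⟩
  rintro _ ⟨y, hy, rfl⟩
  have := h.add_eq hy
  omega

theorem colorDepth_eq (h : StringLengths (R i) e d) (x : X) : colorDepth R i x = d x := by
  rw [colorDepth, h.colorLength_eq, h.colorRank_eq, Nat.add_sub_cancel_left]

theorem colorWeight_eq (h : StringLengths (R i) e d) (x : X) :
    colorWeight R i x = (e x : ℤ) - d x := by
  rw [colorWeight, h.colorRank_eq, h.colorDepth_eq]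

theorem existsUnique_colorDepth_eq (h : StringLengths (R i) e d) {x : X} {n : ℕ}
    (hn : n ≤ d x) : ∃! y, y ∈ comp R i x ∧ colorDepth R i y = n := by
  obtain ⟨y, hy, hy'⟩ := h.exists_d_eq_above hn
  refine ⟨y, ⟨reflTransGen_eqvGen hy, by rw [h.colorDepth_eq, hy']⟩, ?_⟩
  rintro z ⟨hz, hz'⟩
  rw [h.colorDepth_eq] at hz'
  exact h.eq_of_d_eq (hz.symm.trans _ _ _ (reflTransGen_eqvGen hy)) (hz'.trans hy'.symm)

theorem mem_upperPart (h : StringLengths (R i) e d) {x y : X} {p : ℕ} :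
    y ∈ upperPart R i x p ↔ y ∈ comp R i x ∧ d y ≤ p := by
  change (y ∈ comp R i x ∧ _ < 1 + p) ↔ _
  rw [h.ncard_above, Nat.lt_one_add_iff]

end Graph

end StringLengths

theorem isFibrous_of_stringLengths {I X : Type*} {R : ColoredGraph I X} {e d : I → X → ℕ}
    (h : ∀ i, StringLengths (R i) (e i) (d i)) : IsFibrous R := fun i _ _ hy _ hz =>
  (h i).total (hy.symm.trans _ _ _ hz)

/-! ### Fundamental weights of root subsystems -/

section Roots

variable {ι V N : Type*} [AddCommGroup V] [Module ℝ V] [AddCommGroup N] [Module ℝ N]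
  {P : RootPairing ι ℝ V N} (b : P.Base)

theorem pair_eq_coroot' (i : b.support) (v : V) : pair b i v = P.coroot' i v := rfl

theorem pair_add (i : b.support) (v w : V) : pair b i (v + w) = pair b i v + pair b i w := by
  simp [pair_eq_coroot']

theorem pair_sub (i : b.support) (v w : V) : pair b i (v - w) = pair b i v - pair b i w := by
  simp [pair_eq_coroot']

theorem pair_neg (i : b.support) (v : V) : pair b i (-v) = -pair b i v := by
  simp [pair_eq_coroot']

theorem pair_smul (i : b.support) (c : ℝ) (v : V) : pair b i (c • v) = c * pair b i v := by
  simp [pair_eq_coroot']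

theorem pair_sum {α : Type*} (i : b.support) (s : Finset α) (f : α → V) :
    pair b i (∑ a ∈ s, f a) = ∑ a ∈ s, pair b i (f a) := by
  simp [pair_eq_coroot']

theorem pair_root_self (i : b.support) : pair b i (P.root i) = 2 := by
  simp [pair_eq_coroot']

theorem reflection_eq (i : b.support) (v : V) :
    P.reflection i v = v - pair b i v • P.root i := rfl

theorem linearIndependent_root : LinearIndependent ℝ fun i : b.support => P.root i :=
  b.linearIndepOn_root

/-- Principal submatrices of the Cartan matrix are invertible: a vector `u` of the span of
`{α_j | j ∈ J}` that pairs to zero with all `α_k^∨`, `k ∈ J`, is orthogonal to itself for the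
positive definite form `(x, y) = ∑_β ⟨x, β^∨⟩ ⟨y, β^∨⟩`. -/
theorem isUnit_cartanSubmatrix [Finite ι] [P.IsRootSystem] (J : Finset b.support)
    [DecidableEq J] :
    IsUnit (Matrix.of fun j k : J => pair b k (P.root j.1)).det := by
  have := Fintype.ofFinite ι
  rw [isUnit_iff_ne_zero]
  intro hdet
  obtain ⟨v, hv, hvM⟩ := Matrix.exists_vecMul_eq_zero_iff.mpr hdet
  set u : V := ∑ j : J, v j • P.root j.1 with hu
  have hpair : ∀ k : J, P.coroot' k.1 u = 0 := by
    intro k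
    have := congrFun hvM k
    simpa [Matrix.vecMul, dotProduct, hu, pair_eq_coroot'] using this
  have horth : ∀ k : J, P.RootForm (P.root k.1) u = 0 := by
    intro k
    have h := congrArg (P.toLinearMap u) (P.rootForm_self_smul_coroot k.1)
    rw [map_smul, map_nsmul, P.toLinearMap_apply_apply_Polarization] at h
    have h0 : P.toLinearMap u (P.coroot k.1) = 0 := hpair k
    rw [h0, smul_zero] at h
    simpa using h.symm
  have huu : P.RootForm u u = 0 := by
    nth_rw 1 [hu]
    simp only [map_sum, map_smul, LinearMap.sum_apply, LinearMap.smul_apply, horth, smul_zero,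
      Finset.sum_const_zero]
  have hu0 : u = 0 := P.eq_zero_of_mem_rootSpan_of_rootForm_self_eq_zero
    (by simp [RootPairing.rootSpan]) huu
  have hli := (linearIndependent_root b).comp (Subtype.val : J → b.support) Subtype.val_injective
  apply hv
  funext j
  exact Fintype.linearIndependent_iff.mp hli v hu0 j

open Classical in
theorem pair_fundWeight [Finite ι] [P.IsRootSystem]
    (J : Finset b.support) (j k : J) :
    pair b k (fundWeight b J j) = if j = k then 1 else 0 := by
  have h := congrFun (congrFun (Matrix.nonsing_inv_mul _ (isUnit_cartanSubmatrix b J)) j) k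
  rw [Matrix.mul_apply, Matrix.one_apply] at h
  rw [fundWeight, pair_sum]
  simp only [pair_smul]
  exact h

theorem proj_root [Finite ι] [P.IsRootSystem] (J : Finset b.support) (j : J) :
    proj b J (P.root j.1) = P.root j.1 := by
  classical
  have h := fun l => congrFun (congrFun
    (Matrix.mul_nonsing_inv _ (isUnit_cartanSubmatrix b J)) j) l
  simp only [Matrix.mul_apply, Matrix.one_apply] at h
  simp only [proj, fundWeight, Finset.smul_sum, smul_smul]
  rw [Finset.sum_comm]
  simp only [← Finset.sum_smul]
  calc _ = ∑ l : J, (if j = l then (1 : ℝ) else 0) • P.root l.1 := by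
        refine Finset.sum_congr rfl fun l _ => ?_
        rw [← h l]
        congr 1
    _ = _ := by simp

theorem pair_weightOf [Finite ι] [P.IsRootSystem] (J : Finset b.support) (ν : J → ℤ) (k : J) :
    pair b k (weightOf b J ν) = ν k := by
  classical
  simp only [weightOf, ← Int.cast_smul_eq_zsmul ℝ, pair_sum, pair_smul, pair_fundWeight]
  simp

theorem weightOf_add (J : Finset b.support) (ν ν' : J → ℤ) :
    weightOf b J (fun j => ν j + ν' j) = weightOf b J ν + weightOf b J ν' := by
  simp only [weightOf, add_smul, Finset.sum_add_distrib]

theorem weightOf_sub (J : Finset b.support) (ν ν' : J → ℤ) :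
    weightOf b J (fun j => ν j - ν' j) = weightOf b J ν - weightOf b J ν' := by
  simp only [weightOf, sub_smul, Finset.sum_sub_distrib]

theorem proj_add (J : Finset b.support) (v w : V) :
    proj b J (v + w) = proj b J v + proj b J w := by
  simp only [proj, pair_add, add_smul, Finset.sum_add_distrib]

theorem proj_weightOf_univ [Finite ι] [P.IsRootSystem] (J : Finset b.support)
    (m : b.support → ℤ) :
    proj b J (weightOf b Finset.univ fun j => m j) = weightOf b J fun j => m j := by
  have h : ∀ j : J, pair b j.1 (weightOf b Finset.univ fun j => m j) = (m j : ℝ) := fun j =>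
    pair_weightOf b Finset.univ (fun j => m j) ⟨j.1, Finset.mem_univ _⟩
  simp only [proj, h, Int.cast_smul_eq_zsmul]
  rfl

/-! ### Alternants -/

theorem reflection_mem_weylGroup (J : Finset b.support) (j : J) :
    P.reflection j.1 ∈ weylGroup b J := Subgroup.subset_closure ⟨j, rfl⟩

theorem det_reflection [Finite ι] [P.IsRootSystem] (j : ι) :
    LinearMap.det (P.reflection j : V →ₗ[ℝ] V) = -1 := by
  have : Module.Finite ℝ V := ⟨⟨(Set.finite_range P.root).toFinset, by simp⟩⟩
  have h : (P.reflection j : V →ₗ[ℝ] V) =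
      LinearMap.transvection (P.coroot' j) (-P.root j) := by
    ext v
    simp [RootPairing.reflection_apply, LinearMap.transvection, sub_eq_add_neg]
  rw [h, LinearMap.transvection.det]
  simp
  norm_num

theorem alternant_eq_sum [Finite ι] [P.IsRootSystem] (J : Finset b.support)
    [Fintype (weylGroup b J)] (v : V) :
    alternant b J v = ∑ w : weylGroup b J,
      ((SignType.sign (LinearMap.det (w.1 : V →ₗ[ℝ] V)) : SignType) : ℤ) • expo (w.1 v) :=
  finsum_eq_sum_of_fintype _

theorem alternant_reflection [Finite ι] [P.IsRootSystem] (J : Finset b.support) (j : J) (v : V) :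
    alternant b J (P.reflection j.1 v) = -alternant b J v := by
  have := Fintype.ofFinite (weylGroup b J)
  rw [alternant_eq_sum, alternant_eq_sum, ← Finset.sum_neg_distrib]
  refine Fintype.sum_equiv (Equiv.mulRight ⟨_, reflection_mem_weylGroup b J j⟩) _ _ fun w => ?_
  have h : ((w.1 * P.reflection j.1 : V ≃ₗ[ℝ] V) : V →ₗ[ℝ] V) =
      (w.1 : V →ₗ[ℝ] V) * (P.reflection j.1 : V →ₗ[ℝ] V) := rfl
  change _ = -(((SignType.sign (LinearMap.det ((w.1 * P.reflection j.1 : V ≃ₗ[ℝ] V) :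
    V →ₗ[ℝ] V)) : SignType) : ℤ) • expo (w.1 (P.reflection j.1 v)))
  rw [h, map_mul, det_reflection, mul_neg_one, Left.sign_neg]
  simp

end Roots

/-! ### Vertex colorings yield splitting identities -/

section Splitting

variable {ι V N X : Type*} [AddCommGroup V] [Module ℝ V] [AddCommGroup N] [Module ℝ N]
  {P : RootPairing ι ℝ V N} {b : P.Base} {R : ColoredGraph b.support X}
  {e d : b.support → X → ℕ}

theorem add_wt_mem_dominantWeights (hR : ∀ i, StringLengths (R i) (e i) (d i))
    {J : Finset b.support} {ν : J → ℕ} {m : X} (hm : m ∈ mSet R J ν) :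
    weightOf b J (fun j => (ν j : ℤ)) + wt b R J m ∈ dominantWeights b J := by
  refine ⟨fun j => (ν j + e j m) - d j m, ?_⟩
  rw [wt, ← weightOf_add]
  refine congrArg (weightOf b J) ?_
  funext j
  have := hm j
  rw [(hR j).colorDepth_eq] at this
  rw [(hR j).colorWeight_eq]
  push_cast [Nat.cast_sub (show d j m ≤ ν j + e j m by omega)]
  ring
variable [Finite ι] [P.IsRootSystem]

theorem proj_wt (J : Finset b.support) (x : X) :
    proj b J (wt b R Finset.univ x) = wt b R J x :=
  proj_weightOf_univ b J fun j => colorWeight R j x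

theorem pair_wt (hR : ∀ i, StringLengths (R i) (e i) (d i)) (J : Finset b.support) (j : J) (x : X) :
    pair b j.1 (wt b R J x) = (e j x : ℝ) - d j x := by
  rw [wt, pair_weightOf, (hR j).colorWeight_eq]
  push_cast
  rfl

theorem IsStructured.wt_of_edge (hs : IsStructured b R) {J : Finset b.support} (j : J) {x y : X}
    (hxy : R j x y) : wt b R J x + P.root j.1 = wt b R J y := by
  rw [← proj_wt J x, ← proj_wt J y, ← hs j x y hxy, proj_add, proj_root]

theorem IsStructured.wt_of_mem_comp (hs : IsStructured b R)
    (hR : ∀ i, StringLengths (R i) (e i) (d i)) {J : Finset b.support} (j : J) {x y : X}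
    (hxy : y ∈ comp R j x) :
    wt b R J y = wt b R J x + ((e j y : ℝ) - e j x) • P.root j.1 := by
  induction hxy with
  | rel x y hxy =>
    rw [← hs.wt_of_edge j hxy, ← (hR j).e_succ hxy]
    simp
  | refl x => simp
  | symm x y _ ih => rw [ih]; module
  | trans x y z _ _ ih₁ ih₂ => rw [ih₂, ih₁]; module

/-- If `⟨v, α_j^∨⟩ = q`, then the reflection `s_j` acts on the weights `v + wt^J(x)` like the partial
reflection of the `j`-string of `x` that exchanges the ranks `0, 1, …, l - q` in reverse order. -/
theorem IsStructured.reflection_add_wt (hs : IsStructured b R)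
    (hR : ∀ i, StringLengths (R i) (e i) (d i)) {J : Finset b.support} (j : J) {x y : X}
    (hxy : y ∈ comp R j x) {v : V} {q : ℕ} (hv : pair b j.1 v = q) (hq : e j y + q = d j x) :
    P.reflection j.1 (v + wt b R J x) = v + wt b R J y := by
  have hq' : (d j x : ℝ) = e j y + q := by exact_mod_cast hq.symm
  rw [reflection_eq, pair_add, hv, pair_wt hR, hs.wt_of_mem_comp hR j hxy, hq']
  module

variable [Fintype X]

/-- Reversing all `j`-strings shows that the weights `wt^J` are invariant under `s_j`. -/
theorem IsStructured.sum_wt_invariant {A : Type*} [AddCommMonoid A] (hs : IsStructured b R)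
    (hR : ∀ i, StringLengths (R i) (e i) (d i)) (J : Finset b.support) (w : weylGroup b J)
    (f : V → A) : ∑ x, f (w.1 (wt b R J x)) = ∑ x, f (wt b R J x) := by
  obtain ⟨w, hw⟩ := w
  have hrefl : ∀ (j : J) (f : V → A),
      ∑ x, f (P.reflection j.1 (wt b R J x)) = ∑ x, f (wt b R J x) := by
    intro j f
    have hex : ∀ x, ∃ y ∈ comp R j x, e j y = d j x := fun x =>
      (hR j).exists_e_eq (Nat.le_add_left _ _)
    choose g hg hg' using hex
    have hinv : Function.Involutive g := by
      intro x
      have h₁ := (hR j).add_eq (hg x)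
      have h₂ := (hR j).add_eq (hg (g x))
      have h₃ := hg' x
      have h₄ := hg' (g x)
      exact ((hR j).eq_of_d_eq ((hg x).trans _ _ _ (hg (g x))) (by omega)).symm
    refine Fintype.sum_equiv hinv.toPerm _ _ fun x => ?_
    have := hs.reflection_add_wt hR j (hg x) (v := 0) (q := 0) (by simp [pair_eq_coroot'])
      (by simpa using hg' x)
    rw [zero_add, zero_add] at this
    rw [this]
    rfl
  induction hw using Subgroup.closure_induction'' generalizing f with
  | mem w hw =>
    obtain ⟨j, rfl⟩ := hw
    exact hrefl j f
  | inv_mem w hw =>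
    obtain ⟨j, rfl⟩ := hw
    simpa only [RootPairing.reflection_inv] using hrefl j f
  | one => rfl
  | mul w w' _ _ ihw ihw' => exact (ihw' fun v => f (w v)).trans (ihw f)

theorem restrict_wgf (J : Finset b.support) :
    restrict b J (wgf b R) = ∑ x, expo (wt b R J x) := by
  refine (map_sum (AddMonoidAlgebra.mapDomainLinearMap ℤ ℤ (proj b J)) _ _).trans ?_
  refine Finset.sum_congr rfl fun x _ => ?_
  rw [expo, AddMonoidAlgebra.mapDomainLinearMap_single, proj_wt]
  rfl

theorem IsStructured.alternant_mul_sum (hs : IsStructured b R)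
    (hR : ∀ i, StringLengths (R i) (e i) (d i)) (J : Finset b.support) (v : V) :
    alternant b J v * ∑ x, expo (wt b R J x) = ∑ x, alternant b J (v + wt b R J x) := by
  have := Fintype.ofFinite (weylGroup b J)
  simp only [alternant_eq_sum]
  rw [Finset.sum_mul, Finset.sum_comm]
  refine Finset.sum_congr rfl fun w _ => ?_
  rw [← hs.sum_wt_invariant hR J w expo, Finset.mul_sum]
  refine Finset.sum_congr rfl fun x _ => ?_
  rw [smul_mul_assoc, map_add, expo, expo, expo, AddMonoidAlgebra.single_mul_single, one_mul]

open Classical in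
/-- The vertices outside `M_{J,ν}` cancel in pairs. If `κ(x) = j`, then the `j`-string of `x` without
its topmost `1 + ν_j` elements has constant color `j`, and its reversal is induced by the reflection
`s_j` on the weights `ν + ϱ^J + wt^J`, under which alternants change their sign. -/
theorem IsStructured.sum_alternant_eq_zero (hs : IsStructured b R)
    (hR : ∀ i, StringLengths (R i) (e i) (d i)) {J : Finset b.support} {ν : J → ℕ}
    {κ : {x : X // x ∉ mSet R J ν} → J} (hκ : IsVertexColoring R J ν κ) :
    ∑ x : {x : X // x ∉ mSet R J ν},
      alternant b J (weightOf b J (fun j => (ν j : ℤ)) + rho b J + wt b R J x.1) = 0 := by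
  have hex : ∀ x : {x : X // x ∉ mSet R J ν}, ∃ y : {x : X // x ∉ mSet R J ν},
      y.1 ∈ comp R (κ x) x ∧ κ y = κ x ∧ e (κ x) y.1 + (ν (κ x) + 1) = d (κ x) x.1 := by
    intro x
    have hκx := hκ x
    have hx : x.1 ∈ comp R (κ x) x.1 \ upperPart R (κ x) x.1 (ν (κ x)) := by
      rw [← hκx]
      exact ⟨Relation.EqvGen.refl _, x.2, rfl⟩
    rw [Set.mem_sdiff, (hR (κ x)).mem_upperPart] at hx
    have hd : ν (κ x) + 1 ≤ d (κ x) x.1 := by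
      by_contra hlt
      exact hx.2 ⟨hx.1, by omega⟩
    obtain ⟨y, hy, hye⟩ := (hR (κ x)).exists_e_eq (x := x.1)
      (n := d (κ x) x.1 - (ν (κ x) + 1)) (by omega)
    have hadd := (hR (κ x)).add_eq hy
    have hy' : y ∈ comp R (κ x) x.1 \ upperPart R (κ x) x.1 (ν (κ x)) := by
      rw [Set.mem_sdiff, (hR (κ x)).mem_upperPart]
      exact ⟨hy, fun h => by have := h.2; omega⟩
    rw [← hκx] at hy'
    obtain ⟨-, hyM, hyκ⟩ := hy'
    refine ⟨⟨y, hyM⟩, hy, hyκ, ?_⟩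
    change e (κ x) y + _ = _
    omega
  choose g hg hgκ hge using hex
  have hinv : Function.Involutive g := by
    intro x
    have h₁ := (hR (κ x)).add_eq (hg x)
    have h₂ := hg (g x)
    have h₃ := hge (g x)
    have h₄ := hge x
    rw [hgκ] at h₂ h₃
    have h₅ := (hR (κ x)).add_eq h₂
    exact Subtype.ext ((hR (κ x)).eq_of_d_eq ((hg x).trans _ _ _ h₂) (by omega)).symm
  have hneg : ∀ a : AddMonoidAlgebra ℤ V, a = -a → a = 0 := by
    intro a h
    ext v
    have := congrArg (fun f : AddMonoidAlgebra ℤ V => f.coeff v) h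
    simp only [AddMonoidAlgebra.coeff_neg, Finsupp.neg_apply] at this
    simp only [AddMonoidAlgebra.coeff_zero, Finsupp.zero_apply]
    omega
  apply hneg
  rw [← Finset.sum_neg_distrib]
  refine Fintype.sum_equiv hinv.toPerm _ _ fun x => ?_
  have hv : pair b (κ x).1 (weightOf b J (fun j => (ν j : ℤ)) + rho b J) =
      ((ν (κ x) + 1 : ℕ) : ℝ) := by
    rw [rho, pair_add, pair_weightOf, pair_weightOf]
    push_cast
    rfl
  change _ = -alternant b J (_ + wt b R J (g x).1)
  rw [← hs.reflection_add_wt hR (κ x) (hg x) hv (hge x), alternant_reflection, neg_neg]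

theorem IsStructured.splittingIdentity (hs : IsStructured b R)
    (hR : ∀ i, StringLengths (R i) (e i) (d i)) {J : Finset b.support} {ν : J → ℕ}
    {κ : {x : X // x ∉ mSet R J ν} → J} (hκ : IsVertexColoring R J ν κ) :
    SplittingIdentity b R J ν (mSet R J ν) := by
  classical
  have key : alternant b J (weightOf b J (fun j => (ν j : ℤ)) + rho b J) *
      restrict b J (wgf b R) = ∑ x : X with x ∈ mSet R J ν,
        alternant b J (weightOf b J (fun j => (ν j : ℤ)) + wt b R J x + rho b J) := by
    have h := hs.sum_alternant_eq_zero hR hκ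
    rw [restrict_wgf, hs.alternant_mul_sum hR,
      ← Finset.sum_filter_add_sum_filter_not _ (· ∈ mSet R J ν)]
    rw [Finset.sum_subtype (p := fun x => x ∉ mSet R J ν)
      (Finset.univ.filter fun x => x ∉ mSet R J ν) (by simp)]
    rw [h, add_zero]
    refine Finset.sum_congr rfl fun x _ => ?_
    rw [add_right_comm]
  unfold SplittingIdentity
  simp only [bialternant, ← Finset.sum_div]
  rw [div_mul_eq_mul_div, ← map_mul, key, map_sum]

end Splitting

/-! ### Ranked posets from height functions -/

section Ranked

variable {I X : Type*} {R : ColoredGraph I X}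

/-- A real-valued height function can be shifted on each connected component of a finite graph to
have minimum zero there. -/
theorem exists_nat_rank [Finite X] {r : X → X → Prop} {h : X → ℝ}
    (hh : ∀ x y, r x y → h x + 1 = h y) :
    ∃ ρ : X → ℕ, (∀ x y, r x y → ρ x + 1 = ρ y) ∧
      ∀ x, ∃ y, Relation.EqvGen r x y ∧ ρ y = 0 := by
  have hint : ∀ x y, Relation.EqvGen r x y → ∃ n : ℤ, h y - h x = n := by
    intro x y hxy
    induction hxy with
    | rel x y hxy => exact ⟨1, by rw [← hh x y hxy]; simp⟩
    | refl x => exact ⟨0, by simp⟩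
    | symm x y _ ih =>
      obtain ⟨n, hn⟩ := ih
      exact ⟨-n, by push_cast; rw [← hn]; ring⟩
    | trans x y z _ _ ih₁ ih₂ =>
      obtain ⟨n, hn⟩ := ih₁
      obtain ⟨m, hm⟩ := ih₂
      exact ⟨n + m, by push_cast; rw [← hn, ← hm]; ring⟩
  have hmin : ∀ x, ∃ m, Relation.EqvGen r x m ∧ ∀ y, Relation.EqvGen r x y → h m ≤ h y := fun x =>
    Set.exists_min_image {y | Relation.EqvGen r x y} h (Set.toFinite _) ⟨x, .refl x⟩
  choose m hm hm' using hmin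
  have hnat : ∀ x, ∃ n : ℕ, h x - h (m x) = n := by
    intro x
    obtain ⟨n, hn⟩ := hint _ _ (hm x).symm
    have h0 : (0 : ℝ) ≤ n := by
      rw [← hn]
      exact sub_nonneg.mpr (hm' x x (.refl x))
    lift n to ℕ using (by exact_mod_cast h0)
    exact ⟨n, by simpa using hn⟩
  choose ρ hρ using hnat
  have hconst : ∀ x y, Relation.EqvGen r x y → h (m x) = h (m y) := fun x y hxy =>
    le_antisymm (hm' x _ (hxy.trans _ _ _ (hm y))) (hm' y _ (hxy.symm.trans _ _ _ (hm x)))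
  refine ⟨ρ, fun x y hxy => ?_, fun x => ⟨m x, hm x, ?_⟩⟩
  · have h₁ := hρ x
    have h₂ := hρ y
    have h₃ := hh x y hxy
    have h₄ := hconst x y (.rel _ _ hxy)
    have : (ρ x : ℝ) + 1 = ρ y := by linarith
    exact_mod_cast this
  · have h₁ := hρ (m x)
    rw [← hconst x (m x) (hm x), sub_self] at h₁
    exact_mod_cast h₁.symm

theorem exists_rank_eq_of_between {r : X → X → Prop} {ρ : X → ℕ}
    (hρ : ∀ x y, r x y → ρ x + 1 = ρ y) {x y : X} (hxy : Relation.EqvGen r x y) :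
    ∀ n, (ρ x ≤ n ∧ n ≤ ρ y ∨ ρ y ≤ n ∧ n ≤ ρ x) → ∃ z, ρ z = n := by
  induction hxy with
  | rel x y hxy =>
    intro n hn
    have := hρ x y hxy
    rcases (show n = ρ x ∨ n = ρ y by omega) with rfl | rfl
    exacts [⟨x, rfl⟩, ⟨y, rfl⟩]
  | refl x => exact fun n hn => ⟨x, by omega⟩
  | symm x y _ ih => exact fun n hn => ih n hn.symm
  | trans x y z _ _ ih₁ ih₂ =>
    intro n hn
    by_cases h : ρ x ≤ n ∧ n ≤ ρ y ∨ ρ y ≤ n ∧ n ≤ ρ x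
    · exact ih₁ n h
    · exact ih₂ n (by omega)

theorem isRankedPoset_of_height [Finite X] [Nonempty X]
    (hcolor : ∀ i j s t, R i s t → R j s t → i = j) {h : X → ℝ}
    (hh : ∀ i s t, R i s t → h s + 1 = h t) : IsRankedPoset R := by
  set r : X → X → Prop := fun a b => ∃ i, R i a b with hr
  obtain ⟨ρ, hρ, hρ0⟩ := exists_nat_rank (r := r) (h := h) fun x y ⟨i, hi⟩ => hh i x y hi
  have hlt : ∀ {x y}, Relation.TransGen r x y → ρ x < ρ y := by
    intro x y hxy
    induction hxy with
    | single hxy => have := hρ _ _ hxy; omega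
    | tail _ hyz ih => have := hρ _ _ hyz; omega
  have hanti : ∀ {x y}, Relation.ReflTransGen r x y → Relation.ReflTransGen r y x → x = y := by
    intro x y hxy hyx
    rcases Relation.reflTransGen_iff_eq_or_transGen.mp hxy with h₁ | h₁
    · exact h₁.symm
    rcases Relation.reflTransGen_iff_eq_or_transGen.mp hyx with h₂ | h₂
    · exact h₂
    exact absurd (hlt h₁) (hlt h₂).le.not_gt
  refine ⟨hcolor, ⟨{ le := Relation.ReflTransGen r
                     le_refl := fun _ => .refl
                     le_trans := fun _ _ _ => .trans
                     le_antisymm := fun _ _ => hanti }, fun s t => Iff.rfl, fun s t => ?_⟩, ?_⟩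
  · let _ : PartialOrder X := { le := Relation.ReflTransGen r
                                le_refl := fun _ => .refl
                                le_trans := fun _ _ _ => .trans
                                le_antisymm := fun _ _ => hanti }
    have htrans : ∀ {x y : X}, x < y → Relation.TransGen r x y := fun {x y} hxy =>
      (Relation.reflTransGen_iff_eq_or_transGen.mp hxy.le).resolve_left fun h => hxy.ne h.symm
    have hedge : ∀ {x y : X}, r x y → x < y := fun {x y} hxy =>
      lt_of_le_of_ne (.single hxy) fun h => by subst h; have := hρ _ _ hxy; omega
    change r s t ↔ s ⋖ t
    constructor
    · intro hst
      refine ⟨hedge hst, fun c hsc hct => ?_⟩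
      have h₁ := hlt (htrans hsc)
      have h₂ := hlt (htrans hct)
      have h₃ := hρ _ _ hst
      omega
    · intro hst
      rcases Relation.ReflTransGen.cases_head hst.lt.le with h | ⟨c, hsc, hct⟩
      · exact absurd h hst.lt.ne
      · rcases eq_or_ne c t with rfl | hne
        · exact hsc
        · exact absurd (lt_of_le_of_ne hct hne) (hst.2 (hedge hsc))
  · obtain ⟨x, hx⟩ := Finite.exists_max ρ
    refine ⟨ρ x, ρ, ?_, fun i s t hst => hρ s t ⟨i, hst⟩⟩
    ext n
    constructor
    · rintro ⟨y, rfl⟩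
      exact hx y
    · intro hn
      obtain ⟨y, hxy, hy⟩ := hρ0 x
      exact exists_rank_eq_of_between hρ hxy n (Or.inr ⟨by omega, hn⟩)

end Ranked

/-! ### The poset of an admissible system -/

section Admissible

variable {ι V N X : Type*} [AddCommGroup V] [Module ℝ V] [AddCommGroup N] [Module ℝ N]
  {P : RootPairing ι ℝ V N} {b : P.Base}

theorem exists_height (b : P.Base) : ∃ h : V →ₗ[ℝ] ℝ, ∀ i : b.support, h (P.root i) = 1 := by
  obtain ⟨g, hg⟩ := LinearMap.exists_leftInverse_of_injective
    (Finsupp.linearCombination ℝ fun i : b.support => P.root i)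
    (LinearMap.ker_eq_bot.mpr (linearIndependent_root b))
  refine ⟨Finsupp.linearCombination ℝ (fun _ : b.support => (1 : ℝ)) ∘ₗ g, fun i => ?_⟩
  have h := LinearMap.congr_fun hg (Finsupp.single i 1)
  simp only [LinearMap.comp_apply, Finsupp.linearCombination_single, one_smul,
    LinearMap.id_apply] at h
  simp [h]

namespace SystemData

variable {D : SystemData b X} {t : X → b.support → ℝ} {J : Finset b.support} {ν : J → ℕ}

theorem IsAdmissible.isRankedPoset [Finite X] [Nonempty X] (hD : D.IsAdmissible) :
    IsRankedPoset D.graph := by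
  obtain ⟨h, hh⟩ := exists_height b
  refine isRankedPoset_of_height (h := fun x => h (D.μ x)) ?_ ?_
  · intro i j s t hi hj
    have h₁ := hD.μ_F i t hi.1
    have h₂ := hD.μ_F j t hj.1
    rw [hi.2] at h₁
    rw [hj.2, h₁] at h₂
    exact Subtype.ext (P.root.injective (sub_right_injective h₂))
  · rintro i _ t ⟨ht, rfl⟩
    simp only [hD.μ_F i t ht, map_sub, hh, sub_add_cancel]

theorem markedPoint_congr {x y : X} {k : J} (h : y ∈ comp D.graph k x) :
    D.markedPoint J ν y k = D.markedPoint J ν x k := by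
  have : comp D.graph k y = comp D.graph k x := by
    ext z
    exact ⟨fun hz => h.trans _ _ _ hz, fun hz => h.symm.trans _ _ _ hz⟩
  rw [markedPoint, markedPoint, this]

section Order

variable [LinearOrder b.support]

/-- Whether `j` is the color chosen at `x` depends only on the timings of the other colors that do
not exceed the timing of `j`. -/
theorem isLeast_earliestColors_iff {x : X} {j : J} :
    IsLeast (D.earliestColors t J ν x) j ↔ j ∈ kSet D.graph J ν x ∧
      ∀ k : J, k ≠ j → ∀ T ≤ t (D.markedPoint J ν x j) j,
        (k ∈ kSet D.graph J ν x ∧ t (D.markedPoint J ν x k) k = T) →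
          T = t (D.markedPoint J ν x j) j ∧ j ≤ k := by
  constructor
  · rintro ⟨⟨hj, hmin⟩, hle⟩
    refine ⟨hj, ?_⟩
    rintro k - T hT ⟨hk, rfl⟩
    have heq := le_antisymm hT (hmin k hk)
    exact ⟨heq, hle ⟨hk, fun l hl => heq.trans_le (hmin l hl)⟩⟩
  · rintro ⟨hj, h⟩
    refine ⟨⟨hj, fun k hk => ?_⟩, fun k hk => ?_⟩
    · rcases eq_or_ne k j with rfl | hkj
      · rfl
      · by_contra! hlt
        exact hlt.ne (h k hkj _ hlt.le ⟨hk, rfl⟩).1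
    · rcases eq_or_ne k j with rfl | hkj
      · rfl
      · exact (h k hkj _ (hk.2 j hj) ⟨hk.1, rfl⟩).2

theorem exists_isLeast_earliestColors {x : X} (hx : x ∉ mSet D.graph J ν) :
    ∃ j, IsLeast (D.earliestColors t J ν x) j := by
  have hne : (kSet D.graph J ν x).Nonempty := by
    by_contra hempty
    exact hx fun j => not_lt.mp fun hj => hempty ⟨j, hj⟩
  obtain ⟨i, hi, hmin⟩ := Set.exists_min_image (kSet D.graph J ν x)
    (fun k => t (D.markedPoint J ν x k) k) (Set.toFinite _) hne
  have hne' : (D.earliestColors t J ν x).Nonempty := ⟨i, hi, hmin⟩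
  have hwf : (D.earliestColors t J ν x).IsWF := (Set.toFinite _).isWF
  exact ⟨hwf.min hne', hwf.min_mem hne', fun k hk => hwf.min_le hne' hk⟩

end Order

end SystemData

/-- The coordinate `⟨v, α_i^∨⟩` of a dominant weight, as a natural number. -/
noncomputable def coord (i : b.support) (v : V) : ℕ := ⌊pair b i v⌋₊

variable [Finite ι] [P.IsRootSystem]

theorem pair_eq_coord {v : V} (hv : v ∈ dominantWeights b Finset.univ) (i : b.support) :
    pair b i v = coord i v := by
  obtain ⟨n, rfl⟩ := hv
  have h := pair_weightOf b Finset.univ (fun j => (n j : ℤ)) ⟨i, Finset.mem_univ i⟩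
  rw [coord, show pair b i (weightOf b Finset.univ fun j => (n j : ℤ)) = _ from h]
  simp

theorem eq_weightOf_coord {v : V} (hv : v ∈ dominantWeights b Finset.univ) :
    v = weightOf b Finset.univ fun j => (coord j.1 v : ℤ) := by
  have hc := pair_eq_coord hv
  obtain ⟨n, rfl⟩ := hv
  congr 1
  funext j
  have h := pair_weightOf b Finset.univ (fun j => (n j : ℤ)) j
  rw [hc] at h
  exact_mod_cast h.symm

namespace SystemData

variable {D : SystemData b X}

theorem IsAdmissible.pair_ε (hD : D.IsAdmissible) (i : b.support) (x : X) :
    pair b i (D.ε x) = coord i (D.ε x) := pair_eq_coord (hD.ε_dominant x) i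

theorem IsAdmissible.pair_δ (hD : D.IsAdmissible) (i : b.support) (x : X) :
    pair b i (D.δ x) = -(coord i (-D.δ x) : ℝ) := by
  rw [← pair_eq_coord (hD.neg_δ_dominant x) i, pair_neg, neg_neg]

theorem IsAdmissible.ε_pos_iff (hD : D.IsAdmissible) {i : b.support} {x : X} :
    0 < pair b i (D.ε x) ↔ 0 < coord i (D.ε x) := by
  rw [hD.pair_ε, Nat.cast_pos]

theorem IsAdmissible.δ_neg_iff (hD : D.IsAdmissible) {i : b.support} {x : X} :
    pair b i (D.δ x) < 0 ↔ 0 < coord i (-D.δ x) := by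
  rw [hD.pair_δ, neg_lt_zero, Nat.cast_pos]

/-- The `i`-strings of an admissible system, on which `ε(x,i)` is the rank and `-δ(x,i)` is the
depth. -/
theorem IsAdmissible.stringLengths (hD : D.IsAdmissible) (i : b.support) :
    StringLengths (D.graph i) (fun x => coord i (D.ε x)) (fun x => coord i (-D.δ x)) where
  left_unique := fun h₁ h₂ => h₁.2.symm.trans h₂.2
  right_unique := fun h₁ h₂ => (hD.bijOn i).injOn h₁.1 h₂.1 (h₁.2.trans h₂.2.symm)
  e_succ := by
    rintro _ y ⟨hy, rfl⟩
    have h : pair b i (D.ε (D.F i y)) + 1 = pair b i (D.ε y) := by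
      rw [ε, ε, pair_sub, hD.μ_F i y hy, hD.δ_F i y hy, pair_sub, pair_root_self, pair_sub]
      ring
    rw [hD.pair_ε, hD.pair_ε] at h
    exact_mod_cast h
  d_succ := by
    rintro _ y ⟨hy, rfl⟩
    have h := hD.δ_F i y hy
    rw [hD.pair_δ, hD.pair_δ] at h
    have h' : (coord i (-D.δ y) : ℝ) + 1 = coord i (-D.δ (D.F i y)) := by linarith
    exact_mod_cast h'
  exists_below := fun {y} hy => ⟨D.F i y, hD.ε_pos_iff.mpr hy, rfl⟩
  exists_above := fun {x} hx => (hD.bijOn i).surjOn (hD.δ_neg_iff.mpr hx)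

theorem IsAdmissible.colorDepth_eq (hD : D.IsAdmissible) (i : b.support) (x : X) :
    colorDepth D.graph i x = coord i (-D.δ x) := (hD.stringLengths i).colorDepth_eq x

theorem IsAdmissible.wt_eq (hD : D.IsAdmissible) (x : X) : wt b D.graph Finset.univ x = D.μ x := by
  have h : D.μ x = D.ε x - -D.δ x := by rw [ε]; abel
  rw [h, eq_weightOf_coord (hD.ε_dominant x), eq_weightOf_coord (hD.neg_δ_dominant x),
    ← weightOf_sub, wt]
  congr 1
  funext j
  rw [colorWeight, (hD.stringLengths j).colorRank_eq, hD.colorDepth_eq]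

theorem IsAdmissible.isStructured (hD : D.IsAdmissible) : IsStructured b D.graph := by
  rintro i _ t ⟨ht, rfl⟩
  rw [hD.wt_eq, hD.wt_eq, hD.μ_F i t ht, sub_add_cancel]

/-! ### The coloring by minimal timing -/

variable {t : X → b.support → ℝ} {J : Finset b.support} {ν : J → ℕ}

theorem mem_kSet_iff (hD : D.IsAdmissible) {x : X} {k : J} :
    k ∈ kSet D.graph J ν x ↔ ν k + 1 ≤ coord k.1 (-D.δ x) := by
  change ν k < _ ↔ _
  rw [hD.colorDepth_eq, Nat.lt_iff_add_one_le]

theorem IsAdmissible.existsUnique_marked (hD : D.IsAdmissible) {x : X} {k : J}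
    (hk : k ∈ kSet D.graph J ν x) :
    ∃! y, y ∈ comp D.graph k x ∧ colorDepth D.graph k y = ν k + 1 :=
  (hD.stringLengths k).existsUnique_colorDepth_eq ((mem_kSet_iff hD).mp hk)

theorem IsAdmissible.markedPoint_spec (hD : D.IsAdmissible) {x : X} {k : J}
    (hk : k ∈ kSet D.graph J ν x) :
    D.markedPoint J ν x k ∈ comp D.graph k x ∧
      colorDepth D.graph k (D.markedPoint J ν x k) = ν k + 1 :=
  @Classical.epsilon_spec X _ (hD.existsUnique_marked hk).exists

theorem IsAdmissible.eq_markedPoint (hD : D.IsAdmissible) {x y : X} {k : J}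
    (hk : k ∈ kSet D.graph J ν x) (hy : y ∈ comp D.graph k x)
    (hd : coord k.1 (-D.δ y) = ν k + 1) : y = D.markedPoint J ν x k :=
  (hD.existsUnique_marked hk).unique ⟨hy, by rw [hD.colorDepth_eq, hd]⟩ (hD.markedPoint_spec hk)

theorem IsAdmissible.le_markedPoint (hD : D.IsAdmissible) {x : X} {k : J}
    (hk : k ∈ kSet D.graph J ν x) : D.le k x (D.markedPoint J ν x k) := by
  obtain ⟨y, hy, hd⟩ := (hD.stringLengths k).exists_d_eq_above ((mem_kSet_iff hD).mp hk)
  rw [← hD.eq_markedPoint hk (StringLengths.reflTransGen_eqvGen hy) hd]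
  exact hy

/-- Timing increases downwards along `i`-strings. -/
theorem IsCoherentTiming.antitone (hD : D.IsAdmissible) (ht : D.IsCoherentTiming t)
    {i : b.support} {x y : X} (hxy : D.le i x y) (hy : 0 < coord i (-D.δ y)) :
    t y i ≤ t x i := by
  induction hxy using Relation.ReflTransGen.head_induction_on with
  | refl => rfl
  | head hxz hzy ih =>
    obtain ⟨hz, rfl⟩ := hxz
    have := (hD.stringLengths i).le_of_reflTransGen hzy
    exact ih.trans (ht.mono _ i (hD.δ_neg_iff.mpr (by omega)) hz)

/-- The condition on timings that the coherence axiom speaks about. -/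
theorem marked_timing_iff (hD : D.IsAdmissible) {x : X} {k : J} {T : ℝ} :
    (k ∈ kSet D.graph J ν x ∧ t (D.markedPoint J ν x k) k = T) ↔
      ∃ y, D.le k x y ∧ pair b k.1 (D.δ y) = ((-(ν k + 1 : ℤ) : ℤ) : ℝ) ∧ t y k = T := by
  have hδ : ∀ y, pair b k.1 (D.δ y) = ((-(ν k + 1 : ℤ) : ℤ) : ℝ) ↔
      coord k.1 (-D.δ y) = ν k + 1 := by
    intro y
    rw [hD.pair_δ]
    push_cast
    rw [neg_inj]
    exact_mod_cast Iff.rfl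
  simp only [hδ]
  constructor
  · rintro ⟨hk, hT⟩
    exact ⟨_, hD.le_markedPoint hk, by rw [← hD.colorDepth_eq, (hD.markedPoint_spec hk).2], hT⟩
  · rintro ⟨y, hy, hd, hT⟩
    have hk : k ∈ kSet D.graph J ν x := by
      rw [mem_kSet_iff hD, ← hd]
      exact (hD.stringLengths k).le_of_reflTransGen hy
    exact ⟨hk, by rw [← hD.eq_markedPoint hk (StringLengths.reflTransGen_eqvGen hy) hd, hT]⟩

variable [LinearOrder b.support]

/-- By coherence, the color `j` is chosen at both or at none of two neighbours on a `j`-string. -/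
theorem isLeast_earliestColors_F (hD : D.IsAdmissible) (ht : D.IsCoherentTiming t) {x : X} {j : J}
    (hx : j ∈ kSet D.graph J ν x) (hε : 0 < pair b j.1 (D.ε x)) :
    IsLeast (D.earliestColors t J ν (D.F j x)) j ↔ IsLeast (D.earliestColors t J ν x) j := by
  have hedge : D.graph j (D.F j x) x := ⟨hε, rfl⟩
  have hFx : j ∈ kSet D.graph J ν (D.F j x) := by
    rw [mem_kSet_iff hD] at hx ⊢
    have := (hD.stringLengths j).d_succ hedge
    omega
  have hmark : D.markedPoint J ν (D.F j x) j = D.markedPoint J ν x j :=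
    markedPoint_congr (Relation.EqvGen.rel _ _ hedge).symm
  have hle : t (D.markedPoint J ν x j) j ≤ t x j := by
    refine ht.antitone hD (hD.le_markedPoint hx) ?_
    rw [← hD.colorDepth_eq, (hD.markedPoint_spec hx).2]
    omega
  have hδ : pair b j.1 (D.δ x) < 0 := by
    rw [mem_kSet_iff hD] at hx
    exact hD.δ_neg_iff.mpr (by omega)
  rw [isLeast_earliestColors_iff, isLeast_earliestColors_iff, hmark, and_iff_right hFx,
    and_iff_right hx]
  refine forall_congr' fun k => forall_congr' fun hkj => forall₂_congr fun T hT => ?_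
  rw [marked_timing_iff hD, marked_timing_iff hD,
    ht.coherent x j hδ hε k (fun h => hkj (Subtype.ext h)) _ (by omega) T (hT.trans hle)]

theorem isLeast_earliestColors_congr (hD : D.IsAdmissible) (ht : D.IsCoherentTiming t) {x y : X}
    {j : J} (hx : j ∈ kSet D.graph J ν x) (hy : j ∈ kSet D.graph J ν y)
    (hxy : y ∈ comp D.graph j x) :
    IsLeast (D.earliestColors t J ν x) j ↔ IsLeast (D.earliestColors t J ν y) j := by
  -- both are equivalent to the same condition at the common marked point
  have key : ∀ {z}, j ∈ kSet D.graph J ν z → (IsLeast (D.earliestColors t J ν z) j ↔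
      IsLeast (D.earliestColors t J ν (D.markedPoint J ν z j)) j) := by
    intro z hz
    have hd : j ∈ kSet D.graph J ν (D.markedPoint J ν z j) :=
      (Nat.lt_succ_self _).trans_eq (hD.markedPoint_spec hz).2.symm
    have hle := hD.le_markedPoint hz
    generalize D.markedPoint J ν z j = m at hd hle
    clear hz
    induction hle using Relation.ReflTransGen.head_induction_on with
    | refl => rfl
    | head hab hbm ih =>
      obtain ⟨hb, rfl⟩ := hab
      refine (isLeast_earliestColors_F hD ht ?_ hb).trans ih
      rw [mem_kSet_iff hD] at hd ⊢
      exact hd.trans ((hD.stringLengths j).le_of_reflTransGen hbm)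
  rw [key hx, key hy, markedPoint_congr hxy]

theorem IsAdmissible.isVertexColoring (hD : D.IsAdmissible) (ht : D.IsCoherentTiming t)
    {κ : {x : X // x ∉ mSet D.graph J ν} → J}
    (hκ : ∀ x, IsLeast (D.earliestColors t J ν x.1) (κ x)) :
    IsVertexColoring D.graph J ν κ := by
  intro x
  have hk : ∀ x, κ x ∈ kSet D.graph J ν x.1 := fun x => (hκ x).1.1
  ext y
  rw [Set.mem_sdiff, (hD.stringLengths (κ x)).mem_upperPart]
  constructor
  · rintro ⟨hy, hyM, hyκ⟩
    have hyK := hk ⟨y, hyM⟩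
    rw [hyκ, mem_kSet_iff hD] at hyK
    exact ⟨hy, fun h => (h.2.trans_lt hyK).false⟩
  · rintro ⟨hy, hyU⟩
    have hyK : κ x ∈ kSet D.graph J ν y := by
      rw [mem_kSet_iff hD]
      by_contra hlt
      exact hyU ⟨hy, by omega⟩
    have hyM : y ∉ mSet D.graph J ν := fun h => (h (κ x)).not_gt hyK
    exact ⟨hy, hyM, (hκ ⟨y, hyM⟩).unique
      ((isLeast_earliestColors_congr hD ht (hk x) hyK hy).mp (hκ x))⟩

theorem IsAdmissible.exists_isVertexColoring (hD : D.IsAdmissible) (ht : D.IsCoherentTiming t)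
    (J : Finset b.support) (ν : J → ℕ) :
    ∃ κ : {x : X // x ∉ mSet D.graph J ν} → J,
      (∀ x, IsLeast (D.earliestColors t J ν x.1) (κ x)) ∧ IsVertexColoring D.graph J ν κ := by
  choose κ hκ using fun x : {x : X // x ∉ mSet D.graph J ν} =>
    exists_isLeast_earliestColors (t := t) x.2
  exact ⟨κ, hκ, hD.isVertexColoring ht hκ⟩

end SystemData

end Admissible

end SplittingPoset

theorem theorem7p2 {ι V N X : Type*} [Finite ι] [AddCommGroup V] [Module ℝ V]
    [AddCommGroup N] [Module ℝ N] (P : RootPairing ι ℝ V N) [P.IsRootSystem]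
    [P.IsCrystallographic] [P.IsReduced] (b : P.Base) [Fintype X] [Nonempty X]
    (D : SystemData b X) (hD : D.IsAdmissible) :
    -- the graph is the fibrous edge-colored Hasse diagram of a structured ranked poset
    (IsRankedPoset D.graph ∧ IsFibrous D.graph ∧ IsStructured b D.graph) ∧
    -- the function given by minimal timing, ties broken by the order on `I`, is a coloring
    (∀ t : X → b.support → ℝ, D.IsCoherentTiming t → ∀ [LinearOrder b.support],
      ∀ (J : Finset b.support) (ν : J → ℕ),
        (∀ x ∉ mSet D.graph J ν, ∀ k ∈ kSet D.graph J ν x,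
          ∃! y, y ∈ comp D.graph k x ∧ colorDepth D.graph k y = ν k + 1) ∧
        ∃ κ : {x : X // x ∉ mSet D.graph J ν} → J,
          (∀ x, IsLeast (D.earliestColors t J ν x.1) (κ x)) ∧
          IsVertexColoring D.graph J ν κ) ∧
    -- hence it is a crystalline splitting poset, with splitting sets `M_{J,ν}`
    IsCrystallineSplittingPoset b D.graph ∧
    ∀ (J : Finset b.support) (ν : J → ℕ),
      (∀ m ∈ mSet D.graph J ν,
        (weightOf b J fun j => (ν j : ℤ)) + wt b D.graph J m ∈ dominantWeights b J) ∧
      SplittingIdentity b D.graph J ν (mSet D.graph J ν) := by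
  have hsplit : ∀ (J : Finset b.support) (ν : J → ℕ),
      (∀ m ∈ mSet D.graph J ν,
        (weightOf b J fun j => (ν j : ℤ)) + wt b D.graph J m ∈ dominantWeights b J) ∧
      SplittingIdentity b D.graph J ν (mSet D.graph J ν) := by
    intro J ν
    obtain ⟨t, ht⟩ := hD.timing
    obtain ⟨n, ⟨f⟩⟩ := Finite.exists_equiv_fin b.support
    let _ : LinearOrder b.support := LinearOrder.lift' f f.injective
    obtain ⟨κ, -, hκ⟩ := hD.exists_isVertexColoring ht J ν
    exact ⟨fun m hm => add_wt_mem_dominantWeights hD.stringLengths hm,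
      hD.isStructured.splittingIdentity hD.stringLengths hκ⟩
  have hfib : IsFibrous D.graph := isFibrous_of_stringLengths hD.stringLengths
  refine ⟨⟨hD.isRankedPoset, hfib, hD.isStructured⟩, ?_, ⟨hD.isRankedPoset, hD.isStructured, hfib,
    fun J ν => ⟨mSet D.graph J ν, hsplit J ν⟩⟩, hsplit⟩
  intro t ht _ J ν
  exact ⟨fun x _ k hk => hD.existsUnique_marked hk, hD.exists_isVertexColoring ht J ν⟩
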